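/- Fix an integer $k\ge 1$. The class of $k$-trees is defined recursively: the complete graph $K_k$ is a $k$-tree, and if $T$ is a $k$-tree, then so is every graph obtained from $T$ by adding a new vertex adjacent to exactly the vertices of some $k$-clique of $T$. A sub-$k$-tree of a $k$-tree $T$ is a subgraph of $T$ that is itself a $k$-tree. For a $k$-clique $C$ of a $k$-tree $T$ of order $n$, let $a_i(T;C)$ be the number of sub-$k$-trees of $T$ of order $i$ that contain $C$, let $\phi_{T,C}(x)=\sum_{i=k}^{n}a_i(T;C)x^i$, and let \[\mu(T;C)=\frac{\phi_{T,C}'(1)}{\phi_{T,C}(1)}\] be the local mean order of $T$ at $C$, that is, the average order of the sub-$k$-trees of $T$ containing $C$. The degree of $C$ is the number of $(k+1)$-cliques of $T$ that contain $C$, and $C$ is called major if its degree is at least $3$. Theorem. For every $k$-tree $T$, the maximum of $\mu(T;C)$ over all $k$-cliques $C$ of $T$ is attained at a $k$-clique that is not major; moreover, no major $k$-clique attains this maximum. Consequently, if $T\not\cong K_k$, then every $k$-clique of $T$ at which the maximum is attained has degree $1$ or $2$. -/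

import Mathlib

universe u

/-- `IsKTree k G`: the graph `G` is a `k`-tree (intended for `k ≥ 1`).  A complete graph on `k`
vertices is a `k`-tree, and a graph obtained from a `k`-tree by adding a new vertex `v` adjacent
to exactly the vertices of some `k`-clique is a `k`-tree.  In the second constructor `G` is the new
graph and `G.induce {v}ᶜ` is the old one; the clique `C` avoids `v` as it is a neighbourhood
of `v`. -/
inductive IsKTree (k : ℕ) : ∀ {V : Type u}, SimpleGraph V → Prop
  | complete {V : Type u} [Finite V] (hV : Nat.card V = k) :
      IsKTree k (⊤ : SimpleGraph V)
  | addVertex {V : Type u} (G : SimpleGraph V) (v : V) (C : Finset V)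
      (hC : G.IsNClique k C) (hv : G.neighborSet v = (C : Set V))
      (hG : IsKTree k (G.induce ({v}ᶜ : Set V))) :
      IsKTree k G

/-- A `k`-tree is trivial if it is isomorphic to the complete graph `K_k`. -/
def IsTrivialKTree {V : Type u} (k : ℕ) (T : SimpleGraph V) : Prop :=
  Nonempty (T ≃g (⊤ : SimpleGraph (Fin k)))

/-- A sub-`k`-tree of `T` is a subgraph of `T` (not assumed induced) that is itself a `k`-tree. -/
def IsSubKTree {V : Type u} (k : ℕ) (T : SimpleGraph V) (H : T.Subgraph) : Prop :=
  IsKTree k H.coe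

/-- The number `a_i(T; S)` of sub-`k`-trees of `T` of order `i` that contain the subgraph `S`. -/
noncomputable def subKTreeCount {V : Type u} (k : ℕ) (T : SimpleGraph V) (S : T.Subgraph)
    (i : ℕ) : ℕ :=
  {H : T.Subgraph | IsSubKTree k T H ∧ S ≤ H ∧ H.verts.ncard = i}.ncard

/-- The local sub-`k`-tree polynomial `φ_{T,S}(x) = ∑_{i = |V(S)|}^{|V(T)|} a_i(T; S) x^i`. -/
noncomputable def localSubKTreePolynomial {V : Type u} (k : ℕ) (T : SimpleGraph V)
    (S : T.Subgraph) : Polynomial ℚ :=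
  ∑ i ∈ Finset.Icc S.verts.ncard (Nat.card V),
    Polynomial.C (subKTreeCount k T S i : ℚ) * Polynomial.X ^ i

/-- The local mean order `μ(T; S) = φ'_{T,S}(1) / φ_{T,S}(1)`. -/
noncomputable def localMeanOrder {V : Type u} (k : ℕ) (T : SimpleGraph V)
    (S : T.Subgraph) : ℚ :=
  (Polynomial.derivative (localSubKTreePolynomial k T S)).eval 1 /
    (localSubKTreePolynomial k T S).eval 1

/-- The local mean order `μ(T; C)` at a clique, given by its vertex set `C`: the clique is regarded
as the subgraph of `T` induced by `C`. -/
noncomputable def cliqueMeanOrder {V : Type u} (k : ℕ) (T : SimpleGraph V) (C : Finset V) : ℚ :=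
  localMeanOrder k T ((⊤ : T.Subgraph).induce (C : Set V))

/-- The degree of a `k`-clique `C`: the number of `(k+1)`-cliques of `T` containing `C`. -/
noncomputable def cliqueDegree {V : Type u} (k : ℕ) (T : SimpleGraph V) (C : Finset V) : ℕ :=
  {Q : Finset V | T.IsNClique (k + 1) Q ∧ C ⊆ Q}.ncard

/-- A major `k`-clique is a `k`-clique of degree at least `3`. -/
def IsMajorClique {V : Type u} (k : ℕ) (T : SimpleGraph V) (C : Finset V) : Prop :=
  T.IsNClique k C ∧ 3 ≤ cliqueDegree k T C

/-- The maximum of `μ(T; ·)` over all `k`-cliques of `T` occurs at the `k`-clique `C`. -/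
def AttainsMaxLocalMeanOrder {V : Type u} (k : ℕ) (T : SimpleGraph V) (C : Finset V) : Prop :=
  T.IsNClique k C ∧ ∀ D : Finset V, T.IsNClique k D → cliqueMeanOrder k T D ≤ cliqueMeanOrder k T C

/-! A major clique is never optimal: moving one step into its smallest branch raises the mean. Let
`C` be a `k`-clique with at least three branches, and let `v` be the vertex adjacent to all of `C`
in the branch with the fewest sub-`k`-trees through `C`. Put `Q = C ∪ {v}` and `D = Q \ {u}` with `u
∈ C`. Trees containing `Q` count for both `C` and `D`. Besides these, `C` sees only the `M = s * t`
trees avoiding the branch of `v`, where `s` and `t` count trees through `C` on two sides of the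
rest. `D` sees only `N` trees missing `u`, and adding `u` injects these into the `P` trees through
`Q` inside the branch of `v`. Minimality gives `s, t ≥ P + 1`. A family of `s` trees closed under
suitable vertex deletions has mean excess over `k` at most `(s - 1) / 2`, so the `M` trees are too
small on average to compensate for their number (`mean_lt_mean_of_bounds`).

The structure theory rests on edge counting. A set of at least `k` vertices in a `k`-tree spans at
most the number of edges of a `k`-tree of its order, with equality exactly when it induces a
`k`-tree (`KTreeOn.card_arcs_le`, `KTreeOn.of_isFull`). Hence sub-`k`-trees are induced, and
supermodularity of edge counts lets them be cut and glued along `k`-cliques. Counts then multiply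
across a separation and excesses add. -/

section

open scoped Classical

variable {V : Type u} {k : ℕ} {T : SimpleGraph V}

/-! ### Vertex sets and supermodularity of edge counts -/

/-- The induced subgraph of `T` on the finite vertex set `S` is a `k`-tree. -/
inductive KTreeOn (k : ℕ) (T : SimpleGraph V) : Finset V → Prop
  | clique {S : Finset V} (hS : T.IsNClique k S) : KTreeOn k T S
  | addVertex {S C : Finset V} {v : V} (hS : KTreeOn k T S) (hv : v ∉ S) (hC : T.IsNClique k C)
      (hCS : C ⊆ S) (hadj : ∀ w ∈ S, T.Adj v w ↔ w ∈ C) : KTreeOn k T (insert v S)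

/-- Ordered pairs of adjacent vertices of `S`. -/
noncomputable def arcs (T : SimpleGraph V) (S : Finset V) : Finset (V × V) :=
  (S ×ˢ S).filter fun p => T.Adj p.1 p.2

theorem mem_arcs {S : Finset V} {p : V × V} :
    p ∈ arcs T S ↔ (p.1 ∈ S ∧ p.2 ∈ S) ∧ T.Adj p.1 p.2 := by
  simp [arcs]

/-- The only arcs of the union lying in neither part run between `A \ B` and `B \ A`. Equality
therefore means that no such arc exists, which the next two lemmas use in both directions. -/
theorem card_arcs_add_le (A B : Finset V) :
    (arcs T A).card + (arcs T B).card ≤ (arcs T (A ∪ B)).card + (arcs T (A ∩ B)).card := by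
  rw [← Finset.card_union_add_card_inter]
  refine Nat.add_le_add (Finset.card_le_card ?_) (Finset.card_le_card ?_) <;> intro p <;>
    simp only [Finset.mem_union, Finset.mem_inter, mem_arcs] <;> tauto

theorem card_arcs_add_eq {A B : Finset V} (h : ∀ a ∈ A \ B, ∀ b ∈ B \ A, ¬ T.Adj a b) :
    (arcs T A).card + (arcs T B).card = (arcs T (A ∪ B)).card + (arcs T (A ∩ B)).card := by
  rw [← Finset.card_union_add_card_inter]
  congr 2
  · ext ⟨x, y⟩
    have h1 := h x
    have h2 := h y
    simp only [Finset.mem_union, mem_arcs, Finset.mem_sdiff] at *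
    have := T.adj_comm x y
    grind
  · ext p
    simp only [Finset.mem_inter, mem_arcs]
    tauto

theorem not_adj_of_card_arcs_add_ge {A B : Finset V}
    (h : (arcs T (A ∪ B)).card + (arcs T (A ∩ B)).card ≤ (arcs T A).card + (arcs T B).card) :
    ∀ a ∈ A \ B, ∀ b ∈ B \ A, ¬ T.Adj a b := by
  intro a ha b hb hab
  rw [← Finset.card_union_add_card_inter (arcs T A)] at h
  have hi : arcs T (A ∩ B) = arcs T A ∩ arcs T B := by
    ext p
    simp only [Finset.mem_inter, mem_arcs]
    tauto
  rw [hi] at h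
  have hlt : (arcs T A ∪ arcs T B).card < (arcs T (A ∪ B)).card := by
    refine Finset.card_lt_card ⟨fun p => ?_, fun hs => ?_⟩
    · simp only [Finset.mem_union, mem_arcs]
      tauto
    · rw [Finset.mem_sdiff] at ha hb
      have : (a, b) ∈ arcs T A ∪ arcs T B := hs (by simp [mem_arcs, *])
      simp only [Finset.mem_union, mem_arcs] at this
      tauto
  omega

theorem card_arcs_insert {S : Finset V} {v : V} (hv : v ∉ S) :
    (arcs T (insert v S)).card = (arcs T S).card + 2 * (S.filter (T.Adj v)).card := by
  have h : arcs T (insert v S) = arcs T S ∪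
      ((S.filter (T.Adj v)).image (fun w => (v, w)) ∪
        (S.filter (T.Adj v)).image (fun w => (w, v))) := by
    ext ⟨x, y⟩
    have := T.adj_comm x y
    have := T.loopless.irrefl v
    simp only [mem_arcs, Finset.mem_union, Finset.mem_image, Finset.mem_filter, Finset.mem_insert,
      Prod.mk.injEq]
    grind
  rw [h, Finset.card_union_of_disjoint, Finset.card_union_of_disjoint,
    Finset.card_image_of_injective _ (Prod.mk_right_injective v),
    Finset.card_image_of_injective _ (Prod.mk_left_injective v), two_mul]
  · rw [Finset.disjoint_left]
    rintro ⟨x, y⟩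
    simp only [Finset.mem_image, Finset.mem_filter, Prod.mk.injEq]
    grind
  · rw [Finset.disjoint_left]
    rintro ⟨x, y⟩
    simp only [mem_arcs, Finset.mem_union, Finset.mem_image, Finset.mem_filter, Prod.mk.injEq]
    grind

theorem arcs_subset_offDiag (S : Finset V) : arcs T S ⊆ S.offDiag := by
  intro p hp
  rw [mem_arcs] at hp
  rw [Finset.mem_offDiag]
  exact ⟨hp.1.1, hp.1.2, hp.2.ne⟩

theorem card_arcs_add_card_le (S : Finset V) : (arcs T S).card + S.card ≤ S.card * S.card := by
  have h := Finset.card_le_card (arcs_subset_offDiag (T := T) S)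
  rw [Finset.offDiag_card] at h
  have := Nat.le_mul_self S.card
  omega

theorem card_arcs_add_card_eq_iff (S : Finset V) :
    (arcs T S).card + S.card = S.card * S.card ↔ T.IsClique S := by
  have h := arcs_subset_offDiag (T := T) S
  have hle := Nat.le_mul_self S.card
  have hc := Finset.offDiag_card (s := S)
  constructor
  · intro he
    have heq := Finset.eq_of_subset_of_card_le h (by omega)
    intro x hx y hy hxy
    have : (x, y) ∈ arcs T S := by
      rw [heq, Finset.mem_offDiag]
      exact ⟨hx, hy, hxy⟩
    exact (mem_arcs.1 this).2
  · intro hC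
    have heq : arcs T S = S.offDiag := by
      refine h.antisymm fun p hp => ?_
      rw [Finset.mem_offDiag] at hp
      exact mem_arcs.2 ⟨⟨hp.1, hp.2.1⟩, hC hp.1 hp.2.1 hp.2.2⟩
    rw [heq]
    omega

/-! ### Sub-`k`-trees as sets with extremal edge count -/

/-- `S` has the order and the size of a `k`-tree. -/
def IsFull (k : ℕ) (T : SimpleGraph V) (S : Finset V) : Prop :=
  k ≤ S.card ∧ (arcs T S).card + k * (k + 1) = 2 * k * S.card

theorem isFull_of_isNClique {C : Finset V} (hC : T.IsNClique k C) : IsFull k T C := by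
  have h := (card_arcs_add_card_eq_iff C).2 hC.isClique
  rw [hC.card_eq] at h
  refine ⟨hC.card_eq.ge, ?_⟩
  rw [hC.card_eq]
  nlinarith

theorem isNClique_of_isFull {C : Finset V} (hC : IsFull k T C) (h : C.card = k) :
    T.IsNClique k C := by
  refine ⟨(card_arcs_add_card_eq_iff C).1 ?_, h⟩
  have := hC.2
  rw [h] at this ⊢
  nlinarith

theorem filter_adj_eq {S C : Finset V} {v : V} (hCS : C ⊆ S)
    (hadj : ∀ w ∈ S, T.Adj v w ↔ w ∈ C) : S.filter (T.Adj v) = C := by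
  ext w
  rw [Finset.mem_filter]
  exact ⟨fun h => (hadj w h.1).1 h.2, fun h => ⟨hCS h, (hadj w (hCS h)).2 h⟩⟩

theorem KTreeOn.isFull {S : Finset V} (hS : KTreeOn k T S) : IsFull k T S := by
  induction hS with
  | clique hS => exact isFull_of_isNClique hS
  | addVertex hS hv hC hCS hadj ih =>
    refine ⟨?_, ?_⟩ <;> rw [Finset.card_insert_of_notMem hv]
    · exact ih.1.trans (Nat.le_succ _)
    · rw [card_arcs_insert hv, filter_adj_eq hCS hadj, hC.card_eq]
      have := ih.2
      nlinarith

/-- The last vertex added to `W` has at most `k` neighbours in `S`, so deleting it from `S` costs at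
most `k` edges. -/
theorem KTreeOn.card_arcs_le {W : Finset V} (hW : KTreeOn k T W) :
    ∀ S ⊆ W, k ≤ S.card → (arcs T S).card + k * (k + 1) ≤ 2 * k * S.card := by
  induction hW with
  | clique hW =>
    intro S hS hk
    have := Finset.eq_of_subset_of_card_le hS (by rw [hW.card_eq]; exact hk)
    rw [this]
    exact (isFull_of_isNClique hW).2.le
  | @addVertex W C v hW hv hC hCW hadj ih =>
    intro S hS hk
    by_cases hvS : v ∈ S
    · obtain ⟨R, hvR, rfl⟩ : ∃ R, v ∉ R ∧ insert v R = S :=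
        ⟨S.erase v, Finset.notMem_erase v S, Finset.insert_erase hvS⟩
      have hRW : R ⊆ W := fun x hx => by
        have := hS (Finset.mem_insert_of_mem hx)
        grind
      rw [Finset.card_insert_of_notMem hvR] at hk ⊢
      rcases Nat.lt_or_ge R.card k with hlt | hge
      -- Here the whole set has exactly `k` vertices, so the induction hypothesis does not apply to
      -- `R` and the complete graph supplies the bound.
      · have h := card_arcs_add_card_le (T := T) (insert v R)
        rw [Finset.card_insert_of_notMem hvR] at h
        obtain rfl : k = R.card + 1 := by omega
        nlinarith
      · have h := ih R hRW hge
        have hle : (R.filter (T.Adj v)).card ≤ k := by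
          rw [← hC.card_eq]
          refine Finset.card_le_card fun w hw => ?_
          rw [Finset.mem_filter] at hw
          exact (hadj w (hRW hw.1)).1 hw.2
        rw [card_arcs_insert hvR]
        nlinarith
    · exact ih S (fun x hx => by
        have := hS hx
        rw [Finset.mem_insert] at this
        rcases this with rfl | h
        · exact absurd hx hvS
        · exact h) hk

/-- When the bound is attained on more than `k` vertices, the last vertex must have all `k` of its
possible neighbours in the set, and the rest again attains the bound. -/
theorem KTreeOn.of_isFull {W : Finset V} (hW : KTreeOn k T W) :
    ∀ S ⊆ W, IsFull k T S → KTreeOn k T S := by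
  induction hW with
  | clique hW =>
    intro S hS hF
    have := Finset.eq_of_subset_of_card_le hS (by rw [hW.card_eq]; exact hF.1)
    rw [this]
    exact .clique hW
  | @addVertex W C v hW hv hC hCW hadj ih =>
    intro S hS hF
    by_cases hvS : v ∈ S
    · rcases hF.1.eq_or_lt with heq | hlt
      · exact .clique (isNClique_of_isFull hF heq.symm)
      obtain ⟨R, hvR, rfl⟩ : ∃ R, v ∉ R ∧ insert v R = S :=
        ⟨S.erase v, Finset.notMem_erase v S, Finset.insert_erase hvS⟩
      have hRW : R ⊆ W := fun x hx => by
        have := hS (Finset.mem_insert_of_mem hx)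
        grind
      rw [Finset.card_insert_of_notMem hvR] at hlt
      have hkR : k ≤ R.card := by omega
      have h := hW.card_arcs_le R hRW hkR
      have hsub : R.filter (T.Adj v) ⊆ C := fun w hw => by
        rw [Finset.mem_filter] at hw
        exact (hadj w (hRW hw.1)).1 hw.2
      have hle := Finset.card_le_card hsub
      rw [hC.card_eq] at hle
      have hF2 := hF.2
      rw [card_arcs_insert hvR, Finset.card_insert_of_notMem hvR] at hF2
      have hk : (R.filter (T.Adj v)).card = k := by nlinarith
      have hCe := Finset.eq_of_subset_of_card_le hsub (by rw [hk, hC.card_eq])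
      refine .addVertex (ih R hRW ⟨hkR, by rw [hk] at hF2; nlinarith⟩) hvR hC ?_
        fun w hw => hadj w (hRW hw)
      rw [← hCe]
      exact Finset.filter_subset _ _
    · exact ih S (fun x hx => by
        have := hS hx
        rw [Finset.mem_insert] at this
        rcases this with rfl | h
        · exact absurd hx hvS
        · exact h) hF

/-- The upper bound is modular in the set and the arc count is supermodular, so equality for `A` and
`B` forces equality for union and intersection, and in supermodularity itself. -/
theorem isFull_union_inter {W A B : Finset V} (hW : KTreeOn k T W) (hAW : A ⊆ W) (hBW : B ⊆ W)
    (hA : IsFull k T A) (hB : IsFull k T B) (hAB : k ≤ (A ∩ B).card) :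
    IsFull k T (A ∪ B) ∧ IsFull k T (A ∩ B) ∧ ∀ a ∈ A \ B, ∀ b ∈ B \ A, ¬ T.Adj a b := by
  have h1 := hW.card_arcs_le (A ∪ B) (Finset.union_subset hAW hBW)
    (hA.1.trans (Finset.card_le_card Finset.subset_union_left))
  have h2 := hW.card_arcs_le (A ∩ B) (Finset.inter_subset_left.trans hAW) hAB
  have h3 := card_arcs_add_le (T := T) A B
  have h4 := Finset.card_union_add_card_inter A B
  have hA2 := hA.2
  have hB2 := hB.2
  have h5 : 2 * k * (A ∪ B).card + 2 * k * (A ∩ B).card = 2 * k * A.card + 2 * k * B.card := by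
    rw [← mul_add, ← mul_add, h4]
  refine ⟨⟨hA.1.trans (Finset.card_le_card Finset.subset_union_left), by omega⟩,
    ⟨hAB, by omega⟩, not_adj_of_card_arcs_add_ge (by omega)⟩

theorem isFull_of_union_of_inter {W A B : Finset V} (hW : KTreeOn k T W) (hAW : A ⊆ W)
    (hBW : B ⊆ W) (hU : IsFull k T (A ∪ B)) (hI : IsFull k T (A ∩ B))
    (h : ∀ a ∈ A \ B, ∀ b ∈ B \ A, ¬ T.Adj a b) : IsFull k T A := by
  have hkA := hI.1.trans (Finset.card_le_card Finset.inter_subset_left)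
  have hkB := hI.1.trans (Finset.card_le_card Finset.inter_subset_right)
  have h1 := hW.card_arcs_le A hAW hkA
  have h2 := hW.card_arcs_le B hBW hkB
  have h3 := card_arcs_add_eq h
  have h4 := Finset.card_union_add_card_inter A B
  have hU2 := hU.2
  have hI2 := hI.2
  have h5 : 2 * k * (A ∪ B).card + 2 * k * (A ∩ B).card = 2 * k * A.card + 2 * k * B.card := by
    rw [← mul_add, ← mul_add, h4]
  exact ⟨hkA, by omega⟩

/-! ### Simplicial vertices -/

/-- A `k`-tree other than the `k`-clique `C` has a simplicial vertex of degree `k` off `C`. -/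
theorem KTreeOn.exists_simplicial {S : Finset V} (hS : KTreeOn k T S) :
    ∀ C ⊆ S, T.IsNClique k C → S ≠ C →
      ∃ x ∈ S \ C, ∃ N, T.IsNClique k N ∧ N ⊆ S ∧ ∀ w ∈ S, T.Adj x w ↔ w ∈ N := by
  induction hS with
  | clique hS =>
    intro C hCS hC hne
    exact absurd (Finset.eq_of_subset_of_card_le hCS (by rw [hS.card_eq, hC.card_eq])).symm hne
  | @addVertex S N v hS hv hN hNS hadj ih =>
    intro C hCS hC hne
    by_cases hvC : v ∈ C
    -- As a clique through `v`, `C` lies in `N ∪ {v}`, so a simplicial vertex of `S` off `N` is off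
    -- `C` and not adjacent to `v`. If `S = N`, everything is a `(k + 1)`-clique and any vertex is
    -- simplicial.
    · have hCN : C ⊆ insert v N := fun x hx => by
        by_cases hxv : x = v
        · simp [hxv]
        · have := hC.isClique hvC hx (Ne.symm hxv)
          have hxS := hCS hx
          grind
      by_cases hSN : S = N
      · subst hSN
        have hcl : T.IsNClique (k + 1) (insert v S) := hN.insert fun b hb => (hadj b hb).2 hb
        have hcard := hcl.card_eq
        obtain ⟨x, hxS, hxC⟩ := Finset.exists_mem_notMem_of_card_lt_card
          (by rw [hC.card_eq, hcard]; omega : C.card < (insert v S).card)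
        refine ⟨x, Finset.mem_sdiff.2 ⟨hxS, hxC⟩, (insert v S).erase x,
          ⟨hcl.isClique.subset (Finset.coe_subset.2 (Finset.erase_subset _ _)), by rw [Finset.card_erase_of_mem hxS, hcard]; rfl⟩,
          Finset.erase_subset _ _, fun w hw => ?_⟩
        rw [Finset.mem_erase]
        exact ⟨fun h => ⟨h.ne', hw⟩, fun h => hcl.isClique hxS hw h.1.symm⟩
      · obtain ⟨x, hx, M, hM, hMS, hMadj⟩ := ih N hNS hN hSN
        rw [Finset.mem_sdiff] at hx
        refine ⟨x, ?_, M, hM, hMS.trans (Finset.subset_insert _ _), fun w hw => ?_⟩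
        · rw [Finset.mem_sdiff]
          refine ⟨Finset.mem_insert_of_mem hx.1, fun hxC => ?_⟩
          have := hCN hxC
          grind
        · rcases Finset.mem_insert.1 hw with rfl | hw
          · rw [T.adj_comm, hadj x hx.1]
            exact ⟨fun h => absurd h hx.2, fun h => absurd (hMS h) hv⟩
          · exact hMadj w hw
    · refine ⟨v, by simp [hvC], N, hN, hNS.trans (Finset.subset_insert _ _), fun w hw => ?_⟩
      rcases Finset.mem_insert.1 hw with rfl | hw
      · exact ⟨fun h => absurd h (T.loopless.irrefl _), fun h => absurd (hNS h) hv⟩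
      · exact hadj w hw

theorem isFull_erase {S N : Finset V} {x : V} (hS : IsFull k T S) (hx : x ∈ S) (hNS : N ⊆ S)
    (hN : T.IsNClique k N) (hadj : ∀ w ∈ S, T.Adj x w ↔ w ∈ N) : IsFull k T (S.erase x) := by
  obtain ⟨R, hxR, rfl⟩ : ∃ R, x ∉ R ∧ insert x R = S :=
    ⟨S.erase x, Finset.notMem_erase x S, Finset.insert_erase hx⟩
  rw [Finset.erase_insert hxR]
  have hxN : x ∉ N := fun h => T.loopless.irrefl x ((hadj x hx).2 h)
  have hNR : N ⊆ R := (Finset.subset_insert_iff_of_notMem hxN).1 hNS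
  have h := hS.2
  rw [card_arcs_insert hxR, filter_adj_eq hNR fun w hw => hadj w (Finset.mem_insert_of_mem hw),
    hN.card_eq, Finset.card_insert_of_notMem hxR] at h
  refine ⟨by rw [← hN.card_eq]; exact Finset.card_le_card hNR, by nlinarith⟩

/-! ### Translation between `k`-trees and vertex sets -/

theorem KTreeOn.map {W : Type u} {G : SimpleGraph W} (φ : G ↪g T) {S : Finset W}
    (h : KTreeOn k G S) : KTreeOn k T (S.map φ.toEmbedding) := by
  have hcl : ∀ {n : ℕ} {C : Finset W}, G.IsNClique n C → T.IsNClique n (C.map φ.toEmbedding) := by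
    intro n C hC
    refine ⟨fun x hx y hy hxy => ?_, by rw [Finset.card_map, hC.card_eq]⟩
    simp only [Finset.coe_map, Set.mem_image] at hx hy
    obtain ⟨a, ha, rfl⟩ := hx
    obtain ⟨b, hb, rfl⟩ := hy
    exact φ.map_adj_iff.2 (hC.isClique ha hb fun h => hxy (by rw [h]))
  induction h with
  | clique hS => exact .clique (hcl hS)
  | addVertex hS hv hC hCS hadj ih =>
    rw [Finset.map_insert]
    refine .addVertex ih (by simpa using hv) (hcl hC) (Finset.map_subset_map.2 hCS) ?_
    intro w hw
    obtain ⟨a, ha, rfl⟩ := Finset.mem_map.1 hw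
    rw [Finset.mem_map']
    exact φ.map_adj_iff.trans (hadj a ha)

theorem IsKTree.exists_kTreeOn {G : SimpleGraph V} (h : IsKTree k G) :
    ∃ S, (∀ x, x ∈ S) ∧ KTreeOn k G S := by
  induction h with
  | @complete V hfin hV =>
    have := Fintype.ofFinite V
    refine ⟨Finset.univ, Finset.mem_univ, .clique ⟨fun x _ y _ hxy => hxy, ?_⟩⟩
    rw [Finset.card_univ, ← Nat.card_eq_fintype_card, hV]
  | @addVertex V G v C hC hv hG ih =>
    obtain ⟨S, hS, hKS⟩ := ih
    have hmem : ∀ x, x ∈ S.map (SimpleGraph.Embedding.induce (G := G) {v}ᶜ).toEmbedding ↔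
        x ≠ v := by
      intro x
      rw [Finset.mem_map]
      constructor
      · rintro ⟨y, _, rfl⟩
        exact y.2
      · exact fun hx => ⟨⟨x, hx⟩, hS _, rfl⟩
    have hadj : ∀ w, G.Adj v w ↔ w ∈ C := fun w => by
      rw [← SimpleGraph.mem_neighborSet, hv, Finset.mem_coe]
    refine ⟨_, fun x => ?_, KTreeOn.addVertex (hKS.map (SimpleGraph.Embedding.induce {v}ᶜ))
      (v := v) (by simp [hmem]) hC (fun x hx => ?_) fun w _ => hadj w⟩
    · rw [Finset.mem_insert, hmem]
      exact em _
    · rw [hmem]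
      exact ((hadj x).2 hx).ne'

/-- Quantifying over all embeddings with image `S` lets the induction pass to the subtype with a
vertex removed. -/
theorem KTreeOn.isKTree {S : Finset V} (h : KTreeOn k T S) :
    ∀ {W : Type u} (G : SimpleGraph W) (φ : G ↪g T), (∀ x, x ∈ S ↔ ∃ w, φ w = x) →
      IsKTree k G := by
  induction h with
  | @clique S hS =>
    intro W G φ hφ
    let e : W ≃ S := Equiv.ofBijective (fun w => ⟨φ w, (hφ _).2 ⟨w, rfl⟩⟩)
      ⟨fun a b hab => φ.injective (Subtype.ext_iff.1 hab), fun x => by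
        obtain ⟨w, hw⟩ := (hφ x).1 x.2
        exact ⟨w, Subtype.ext hw⟩⟩
    have : Finite W := Finite.of_equiv _ e.symm
    have hG : G = ⊤ := by
      ext a b
      rw [SimpleGraph.top_adj, ← φ.map_adj_iff]
      exact ⟨fun hab hne => hab.ne (by rw [hne]), fun hab =>
        hS.isClique ((hφ _).2 ⟨a, rfl⟩) ((hφ _).2 ⟨b, rfl⟩) (φ.injective.ne hab)⟩
    rw [hG]
    refine .complete ?_
    rw [Nat.card_congr e, Nat.card_eq_fintype_card, Fintype.card_coe, hS.card_eq]
  | @addVertex S C v hS hv hC hCS hadj ih =>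
    intro W G φ hφ
    obtain ⟨w, rfl⟩ := (hφ v).1 (Finset.mem_insert_self _ _)
    have hC' : ∀ x ∈ C, ∃ w, φ w = x := fun x hx =>
      (hφ x).1 (Finset.mem_insert_of_mem (hCS hx))
    have hmem : ∀ a, a ∈ C.preimage φ φ.injective.injOn ↔ φ a ∈ C := fun a => by simp
    refine .addVertex G w (C.preimage φ φ.injective.injOn) ⟨?_, ?_⟩ ?_
      (ih _ (φ.comp (SimpleGraph.Embedding.induce _)) fun x => ?_)
    · intro a ha b hb hab
      rw [Finset.mem_coe, hmem] at ha hb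
      exact φ.map_adj_iff.1 (hC.isClique ha hb (φ.injective.ne hab))
    · rw [Finset.card_preimage, ← hC.card_eq]
      congr 1
      exact Finset.filter_true_of_mem fun x hx => hC' x hx
    · ext a
      rw [SimpleGraph.mem_neighborSet, Finset.mem_coe, hmem, ← φ.map_adj_iff]
      by_cases ha : φ a ∈ S
      · exact hadj _ ha
      · have haw := (hφ (φ a)).2 ⟨a, rfl⟩
        rw [Finset.mem_insert, or_iff_left ha] at haw
        rw [haw]
        exact ⟨fun h => absurd h (T.loopless.irrefl _), fun h => absurd (hCS h) hv⟩
    · constructor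
      · intro hx
        obtain ⟨a, rfl⟩ := (hφ x).1 (Finset.mem_insert_of_mem hx)
        refine ⟨⟨a, fun h => hv ?_⟩, rfl⟩
        rw [Set.mem_singleton_iff] at h
        rwa [← h]
      · rintro ⟨⟨a, ha⟩, rfl⟩
        have haw := (hφ (φ a)).2 ⟨a, rfl⟩
        rcases Finset.mem_insert.1 haw with h | h
        · exact absurd (φ.injective h) ha
        · exact h

theorem isSubKTree_iff [Fintype V] (hT : KTreeOn k T Finset.univ) (H : T.Subgraph) :
    IsSubKTree k T H ↔ ∃ S : Finset V, IsFull k T S ∧ H = (⊤ : T.Subgraph).induce S := by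
  constructor
  · intro hH
    obtain ⟨R, hR, hKR⟩ := IsKTree.exists_kTreeOn hH
    have hF := hKR.isFull
    set S : Finset V := R.map (Function.Embedding.subtype _) with hS
    have hmem : ∀ x, x ∈ S ↔ x ∈ H.verts := fun x => by
      rw [hS, Finset.mem_map]
      exact ⟨fun ⟨y, _, hy⟩ => hy ▸ y.2, fun hx => ⟨⟨x, hx⟩, hR _, rfl⟩⟩
    have hcard : S.card = R.card := Finset.card_map _
    have hsub : (arcs H.coe R).map ((Function.Embedding.subtype _).prodMap
        (Function.Embedding.subtype _)) ⊆ arcs T S := by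
      intro p hp
      obtain ⟨q, hq, rfl⟩ := Finset.mem_map.1 hp
      rw [mem_arcs] at hq ⊢
      exact ⟨⟨(hmem _).2 q.1.2, (hmem _).2 q.2.2⟩, hq.2.adj_sub⟩
    -- `H` already has the largest number of arcs that `T` can have on these vertices, so the
    -- inclusion of arcs is an equality and `H` is induced.
    have hle := hT.card_arcs_le S (Finset.subset_univ _) (by rw [hcard]; exact hF.1)
    have hF2 := hF.2
    rw [← hcard] at hF2
    have heq := Finset.eq_of_subset_of_card_le hsub (by rw [Finset.card_map]; omega)
    have hc := congrArg Finset.card heq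
    rw [Finset.card_map] at hc
    refine ⟨S, ⟨hcard ▸ hF.1, by omega⟩, ?_⟩
    ext x y
    · simp [hmem]
    · simp only [SimpleGraph.Subgraph.induce_adj, Finset.mem_coe, SimpleGraph.Subgraph.top_adj]
      refine ⟨fun h => ⟨(hmem _).2 (H.edge_vert h), (hmem _).2 (H.edge_vert h.symm), h.adj_sub⟩,
        fun h => ?_⟩
      have : (x, y) ∈ arcs T S := mem_arcs.2 ⟨⟨h.1, h.2.1⟩, h.2.2⟩
      rw [← heq, Finset.mem_map] at this
      obtain ⟨q, hq, hqe⟩ := this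
      have h1 : (q.1 : V) = x := congrArg Prod.fst hqe
      have h2 : (q.2 : V) = y := congrArg Prod.snd hqe
      rw [← h1, ← h2]
      exact (mem_arcs.1 hq).2
  · rintro ⟨S, hS, rfl⟩
    refine (hT.of_isFull S (Finset.subset_univ _) hS).isKTree _
      ⟨⟨fun x => x.1, Subtype.val_injective⟩, ?_⟩ fun x => ?_
    · intro a b
      have ha := a.2
      have hb := b.2
      simp only [SimpleGraph.Subgraph.induce_verts, Finset.mem_coe] at ha hb
      simp [ha, hb]
    · constructor
      · exact fun hx => ⟨⟨x, hx⟩, rfl⟩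
      · rintro ⟨w, rfl⟩
        exact w.2

/-! ### Mean order as an average over vertex sets -/

/-- Vertex sets of the sub-`k`-trees of `T` that contain `C` and lie inside `U`. -/
noncomputable def treesBetween [Fintype V] (k : ℕ) (T : SimpleGraph V) (C U : Finset V) :
    Finset (Finset V) :=
  Finset.univ.filter fun S => IsFull k T S ∧ C ⊆ S ∧ S ⊆ U

theorem mem_treesBetween [Fintype V] {C U S : Finset V} :
    S ∈ treesBetween k T C U ↔ IsFull k T S ∧ C ⊆ S ∧ S ⊆ U := by
  simp [treesBetween]

theorem self_mem_treesBetween [Fintype V] {C U : Finset V} (hC : T.IsNClique k C) (hU : C ⊆ U) :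
    C ∈ treesBetween k T C U :=
  mem_treesBetween.2 ⟨isFull_of_isNClique hC, subset_rfl, hU⟩

theorem subKTreeCount_eq [Fintype V] (hT : KTreeOn k T Finset.univ) (C : Finset V) (i : ℕ) :
    subKTreeCount k T ((⊤ : T.Subgraph).induce C) i =
      ((treesBetween k T C Finset.univ).filter fun S => S.card = i).card := by
  have himg : {H : T.Subgraph | IsSubKTree k T H ∧ (⊤ : T.Subgraph).induce C ≤ H ∧
      H.verts.ncard = i} = (fun S : Finset V => (⊤ : T.Subgraph).induce (S : Set V)) ''
        ((treesBetween k T C Finset.univ).filter fun S => S.card = i : Finset (Finset V)) := by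
    ext H
    simp only [Set.mem_ofPred_eq, isSubKTree_iff hT, Set.mem_image, Finset.mem_coe,
      Finset.mem_filter, mem_treesBetween]
    constructor
    · rintro ⟨⟨S, hS, rfl⟩, hle, hi⟩
      refine ⟨S, ⟨⟨hS, ?_, Finset.subset_univ _⟩, ?_⟩, rfl⟩
      · exact Finset.coe_subset.1 hle.1
      · rwa [SimpleGraph.Subgraph.induce_verts, Set.ncard_coe_finset] at hi
    · rintro ⟨S, ⟨⟨hS, hCS, _⟩, hi⟩, rfl⟩
      refine ⟨⟨S, hS, rfl⟩, SimpleGraph.Subgraph.induce_mono_right (Finset.coe_subset.2 hCS), ?_⟩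
      rwa [SimpleGraph.Subgraph.induce_verts, Set.ncard_coe_finset]
  rw [subKTreeCount, himg, Set.ncard_image_of_injective, Set.ncard_coe_finset]
  intro S R hSR
  exact Finset.coe_injective (congrArg SimpleGraph.Subgraph.verts hSR)

/-- The total number of vertices outside a `k`-clique, over a family of sub-`k`-trees. -/
noncomputable def totalExcess (k : ℕ) (A : Finset (Finset V)) : ℚ :=
  ∑ S ∈ A, ((S.card : ℚ) - k)

/-- Subtracting `k` makes the weight of a tree additive under gluing along a `k`-clique. -/
theorem cliqueMeanOrder_eq [Fintype V] (hT : KTreeOn k T Finset.univ) {C : Finset V}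
    (hC : T.IsNClique k C) :
    cliqueMeanOrder k T C = k + totalExcess k (treesBetween k T C Finset.univ) /
      (treesBetween k T C Finset.univ).card := by
  set A := treesBetween k T C Finset.univ with hA
  have hmaps : ∀ S ∈ A, S.card ∈ Finset.Icc k (Fintype.card V) := fun S hS =>
    Finset.mem_Icc.2 ⟨(mem_treesBetween.1 hS).1.1, Finset.card_le_univ S⟩
  have hpos : (0 : ℚ) < A.card := by
    exact_mod_cast Finset.card_pos.2 ⟨C, self_mem_treesBetween hC (Finset.subset_univ _)⟩
  have h1 : (localSubKTreePolynomial k T ((⊤ : T.Subgraph).induce C)).eval 1 = A.card := by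
    simp only [localSubKTreePolynomial, subKTreeCount_eq hT, SimpleGraph.Subgraph.induce_verts,
      Set.ncard_coe_finset, hC.card_eq, Nat.card_eq_fintype_card, Polynomial.eval_finsetSum]
    simp only [Polynomial.eval_mul, Polynomial.eval_C, Polynomial.eval_pow, Polynomial.eval_X,
      one_pow, mul_one]
    rw [← Nat.cast_sum, ← Finset.card_eq_sum_card_fiberwise hmaps]
  have h2 : (Polynomial.derivative (localSubKTreePolynomial k T
      ((⊤ : T.Subgraph).induce C))).eval 1 = ∑ S ∈ A, (S.card : ℚ) := by
    simp only [localSubKTreePolynomial, subKTreeCount_eq hT, SimpleGraph.Subgraph.induce_verts,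
      Set.ncard_coe_finset, hC.card_eq, Nat.card_eq_fintype_card, Polynomial.derivative_sum,
      Polynomial.eval_finsetSum]
    rw [← Finset.sum_fiberwise_of_maps_to hmaps]
    refine Finset.sum_congr rfl fun i _ => ?_
    rw [Finset.sum_congr rfl fun S hS => by rw [(Finset.mem_filter.1 hS).2],
      Finset.sum_const, nsmul_eq_mul]
    simp [Polynomial.derivative_X_pow, hA]
  rw [cliqueMeanOrder, localMeanOrder, h1, h2, totalExcess, Finset.sum_sub_distrib,
    Finset.sum_const, nsmul_eq_mul]
  field_simp
  ring

theorem isFull_of_isNClique_succ {Q : Finset V} (hQ : T.IsNClique (k + 1) Q) : IsFull k T Q := by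
  have h := (card_arcs_add_card_eq_iff Q).2 hQ.isClique
  rw [hQ.card_eq] at h
  refine ⟨by rw [hQ.card_eq]; exact Nat.le_succ k, ?_⟩
  rw [hQ.card_eq]
  nlinarith

/-! ### Branches at a clique -/

theorem exists_isFull_erase [Fintype V] (hT : KTreeOn k T Finset.univ) {C S : Finset V}
    (hC : T.IsNClique k C) (hS : IsFull k T S) (hCS : C ⊆ S) (hne : S ≠ C) :
    ∃ x ∈ S \ C, IsFull k T (S.erase x) ∧ C ⊆ S.erase x ∧
      ∃ N, T.IsNClique k N ∧ N ⊆ S.erase x ∧ ∀ w ∈ S, T.Adj x w ↔ w ∈ N := by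
  obtain ⟨x, hx, N, hN, hNS, hadj⟩ :=
    (hT.of_isFull S (Finset.subset_univ _) hS).exists_simplicial C hCS hC hne
  have hxS := Finset.mem_sdiff.1 hx
  refine ⟨x, hx, isFull_erase hS hxS.1 hNS hN hadj, Finset.subset_erase.2 ⟨hCS, hxS.2⟩, N, hN,
    Finset.subset_erase.2 ⟨hNS, fun h => T.loopless.irrefl x ((hadj x hxS.1).2 h)⟩, hadj⟩

/-- Strip simplicial vertices off `C` one by one; the last one removed has its `k` neighbours in
`C`, hence all of `C`. -/
theorem exists_adj_clique [Fintype V] (hT : KTreeOn k T Finset.univ) {C : Finset V}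
    (hC : T.IsNClique k C) (S : Finset V) :
    IsFull k T S → C ⊆ S → S ≠ C → ∃ v ∈ S \ C, ∀ u ∈ C, T.Adj v u := by
  induction S using Finset.strongInduction with
  | H S ih =>
    intro hS hCS hne
    obtain ⟨x, hx, hF, hCx, N, hN, hNS, hadj⟩ := exists_isFull_erase hT hC hS hCS hne
    by_cases he : S.erase x = C
    · have hNC := Finset.eq_of_subset_of_card_le (he ▸ hNS) (by rw [hN.card_eq, hC.card_eq])
      exact ⟨x, hx, fun u hu => (hadj u (hCS hu)).2 (hNC ▸ hu)⟩
    · obtain ⟨v, hv, h⟩ := ih _ (Finset.erase_ssubset (Finset.mem_sdiff.1 hx).1) hF hCx he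
      refine ⟨v, ?_, h⟩
      rw [Finset.mem_sdiff] at hv ⊢
      exact ⟨Finset.mem_of_mem_erase hv.1, hv.2⟩

/-- `c` labels the vertices so that adjacent vertices off `C` get equal labels, while distinct
vertices adjacent to all of `C` get distinct labels. -/
structure IsBranchLabel (T : SimpleGraph V) (C S : Finset V) (c : V → V) : Prop where
  adj : ∀ x ∈ S \ C, ∀ y ∈ S \ C, T.Adj x y → c x = c y
  atom : ∀ v ∈ S \ C, (∀ u ∈ C, T.Adj v u) → c v = v

/-- Put back a simplicial vertex `x` with neighbourhood `N`. If `N ⊆ C`, then `x` starts a new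
branch under its own name. Otherwise `N` is a clique, so its vertices off `C` share one label, which
`x` inherits; in that case `x` cannot be adjacent to all of `C`, since `N` would equal `C`. -/
theorem exists_isBranchLabel [Fintype V] (hT : KTreeOn k T Finset.univ) {C : Finset V}
    (hC : T.IsNClique k C) (S : Finset V) :
    IsFull k T S → C ⊆ S → ∃ c, IsBranchLabel T C S c := by
  induction S using Finset.strongInduction with
  | H S ih =>
    intro hS hCS
    by_cases hne : S = C
    · subst hne
      exact ⟨id, by simp, by simp⟩
    obtain ⟨x, hx, hF, hCx, N, hN, hNS, hadj⟩ := exists_isFull_erase hT hC hS hCS hne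
    rw [Finset.mem_sdiff] at hx
    obtain ⟨c, hc⟩ := ih _ (Finset.erase_ssubset hx.1) hF hCx
    have hmem : ∀ y ∈ S \ C, y ≠ x → y ∈ S.erase x \ C := fun y hy hyx => by
      rw [Finset.mem_sdiff] at hy ⊢
      exact ⟨Finset.mem_erase.2 ⟨hyx, hy.1⟩, hy.2⟩
    obtain ⟨l, hl, hlx⟩ : ∃ l, (∀ y ∈ S \ C, y ≠ x → T.Adj x y → c y = l) ∧
        ((∀ u ∈ C, T.Adj x u) → l = x) := by
      by_cases hNC : N ⊆ C
      · refine ⟨x, fun y hy _ hxy => ?_, fun _ => rfl⟩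
        rw [Finset.mem_sdiff] at hy
        exact absurd (hNC ((hadj y hy.1).1 hxy)) hy.2
      · obtain ⟨z, hzN, hzC⟩ := Finset.not_subset.1 hNC
        refine ⟨c z, fun y hy hyx hxy => ?_, fun hall => ?_⟩
        · by_cases hyz : y = z
          · rw [hyz]
          · refine hc.adj y (hmem y hy hyx) z (Finset.mem_sdiff.2 ⟨hNS hzN, hzC⟩)
              (hN.isClique ((hadj y (Finset.mem_sdiff.1 hy).1).1 hxy) hzN hyz)
        · have hCN : C ⊆ N := fun u hu => (hadj u (hCS hu)).1 (hall u hu)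
          have := Finset.eq_of_subset_of_card_le hCN (by rw [hN.card_eq, hC.card_eq])
          exact absurd (this ▸ hzN) hzC
    refine ⟨Function.update c x l, fun y hy z hz hyz => ?_, fun v hv hall => ?_⟩
    · by_cases hyx : y = x
      · subst hyx
        rw [Function.update_self, Function.update_of_ne hyz.ne', hl z hz hyz.ne' hyz]
      · rw [Function.update_of_ne hyx]
        by_cases hzx : z = x
        · subst hzx
          rw [Function.update_self, hl y hy hyx hyz.symm]
        · rw [Function.update_of_ne hzx, hc.adj y (hmem y hy hyx) z (hmem z hz hzx) hyz]
    · by_cases hvx : v = x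
      · subst hvx
        rw [Function.update_self, hlx hall]
      · rw [Function.update_of_ne hvx, hc.atom v (hmem v hv hvx) hall]

/-! ### Cutting and gluing along a clique -/

/-- `C` separates `A` from `B`. -/
structure Separates (T : SimpleGraph V) (C A B : Finset V) : Prop where
  subset_left : C ⊆ A
  subset_right : C ⊆ B
  inter_subset : A ∩ B ⊆ C
  not_adj : ∀ a ∈ A \ C, ∀ b ∈ B \ C, ¬ T.Adj a b

theorem Separates.isFull_inter_left [Fintype V] (hT : KTreeOn k T Finset.univ)
    {C A B S : Finset V} (h : Separates T C A B) (hC : T.IsNClique k C) (hS : IsFull k T S)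
    (hCS : C ⊆ S) (hSAB : S ⊆ A ∪ B) : IsFull k T (S ∩ A) := by
  have hA := h.subset_left
  have hB := h.subset_right
  have hi := h.inter_subset
  refine isFull_of_union_of_inter (B := S ∩ B) hT (Finset.subset_univ _) (Finset.subset_univ _)
    ?_ ?_ fun a ha b hb => h.not_adj a ?_ b ?_
  · rwa [← Finset.inter_union_distrib_left, Finset.inter_eq_left.2 hSAB]
  · have : S ∩ A ∩ (S ∩ B) = C := by grind
    rw [this]
    exact isFull_of_isNClique hC
  · grind
  · grind

theorem Separates.symm {C A B : Finset V} (h : Separates T C A B) : Separates T C B A :=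
  ⟨h.subset_right, h.subset_left, by rw [Finset.inter_comm]; exact h.inter_subset,
    fun a ha b hb hab => h.not_adj b hb a ha hab.symm⟩

/-- Trees correspond to pairs by `S ↦ (S ∩ A, S ∩ B)`, with union as inverse. Besides `Q = C`, the
clique `Q = C ∪ {v}` is needed later. -/
theorem Separates.sum_eq [Fintype V] (hT : KTreeOn k T Finset.univ) {C A B Q : Finset V}
    (h : Separates T C A B) (hC : T.IsNClique k C) (hCQ : C ⊆ Q) (hQA : Q ⊆ A)
    (g : Finset V → ℚ) :
    ∑ S ∈ treesBetween k T Q (A ∪ B), g S =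
      ∑ p ∈ treesBetween k T Q A ×ˢ treesBetween k T C B, g (p.1 ∪ p.2) := by
  have hA := h.subset_left
  have hB := h.subset_right
  have hi := h.inter_subset
  refine Finset.sum_nbij' (fun S => (S ∩ A, S ∩ B)) (fun p => p.1 ∪ p.2) ?_ ?_ ?_ ?_ ?_
  · intro S hS
    rw [mem_treesBetween] at hS
    rw [Finset.mem_product, mem_treesBetween, mem_treesBetween]
    refine ⟨⟨h.isFull_inter_left hT hC hS.1 (hCQ.trans hS.2.1) hS.2.2,
      Finset.subset_inter hS.2.1 hQA, Finset.inter_subset_right⟩,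
      h.symm.isFull_inter_left hT hC hS.1 (hCQ.trans hS.2.1) ?_,
      Finset.subset_inter (hCQ.trans hS.2.1) hB, Finset.inter_subset_right⟩
    rw [Finset.union_comm]
    exact hS.2.2
  · intro p hp
    rw [Finset.mem_product, mem_treesBetween, mem_treesBetween] at hp
    obtain ⟨⟨h1, h2, h3⟩, h4, h5, h6⟩ := hp
    rw [mem_treesBetween]
    refine ⟨(isFull_union_inter hT (Finset.subset_univ _) (Finset.subset_univ _) h1 h4 ?_).1,
      h2.trans Finset.subset_union_left, Finset.union_subset_union h3 h6⟩
    rw [← hC.card_eq]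
    exact Finset.card_le_card (Finset.subset_inter (hCQ.trans h2) h5)
  · intro S hS
    rw [mem_treesBetween] at hS
    simp only
    rw [← Finset.inter_union_distrib_left, Finset.inter_eq_left.2 hS.2.2]
  · intro p hp
    rw [Finset.mem_product, mem_treesBetween, mem_treesBetween] at hp
    obtain ⟨⟨h1, h2, h3⟩, h4, h5, h6⟩ := hp
    ext x
    · simp only
      grind
    · simp only
      grind
  · intro S hS
    rw [mem_treesBetween] at hS
    simp only
    rw [← Finset.inter_union_distrib_left, Finset.inter_eq_left.2 hS.2.2]

theorem Separates.card_eq [Fintype V] (hT : KTreeOn k T Finset.univ) {C A B Q : Finset V}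
    (h : Separates T C A B) (hC : T.IsNClique k C) (hCQ : C ⊆ Q) (hQA : Q ⊆ A) :
    ((treesBetween k T Q (A ∪ B)).card : ℚ) =
      (treesBetween k T Q A).card * (treesBetween k T C B).card := by
  have := h.sum_eq hT hC hCQ hQA fun _ => 1
  simpa using this

theorem Separates.totalExcess_eq [Fintype V] (hT : KTreeOn k T Finset.univ) {C A B Q : Finset V}
    (h : Separates T C A B) (hC : T.IsNClique k C) (hCQ : C ⊆ Q) (hQA : Q ⊆ A) :
    totalExcess k (treesBetween k T Q (A ∪ B)) =
      (treesBetween k T C B).card * totalExcess k (treesBetween k T Q A) +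
      (treesBetween k T Q A).card * totalExcess k (treesBetween k T C B) := by
  have hsum : ∀ p ∈ treesBetween k T Q A ×ˢ treesBetween k T C B,
      (((p.1 ∪ p.2).card : ℚ) - k) = (p.1.card - k) + (p.2.card - k) := by
    intro p hp
    rw [Finset.mem_product, mem_treesBetween, mem_treesBetween] at hp
    obtain ⟨⟨h1, h2, h3⟩, h4, h5, h6⟩ := hp
    have hi : p.1 ∩ p.2 = C := by
      have := h.inter_subset
      grind
    have hcard := Finset.card_union_add_card_inter p.1 p.2
    rw [hi, hC.card_eq] at hcard
    have : ((p.1 ∪ p.2).card : ℚ) + k = p.1.card + p.2.card := by exact_mod_cast hcard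
    linarith
  rw [totalExcess, h.sum_eq hT hC hCQ hQA, Finset.sum_congr rfl hsum, Finset.sum_add_distrib,
    Finset.sum_product, Finset.sum_product]
  simp only [Finset.sum_const, nsmul_eq_mul, totalExcess, Finset.mul_sum]

/-! ### The bound on mean excess -/

/-- Deletions within `A` make every size from `k` up to the maximum occur, so a largest member has
excess at most `A.card - 1`. Removing it preserves the closure property, and the bounds sum to a
triangular number. -/
theorem two_mul_sum_card_sub_le (k : ℕ) (A : Finset (Finset V))
    (hA : ∀ S ∈ A, k ≤ S.card ∧ (S.card ≠ k → ∃ x ∈ S, S.erase x ∈ A)) :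
    2 * totalExcess k A ≤ A.card * (A.card - 1) := by
  induction hn : A.card generalizing A with
  | zero => simp [totalExcess, Finset.card_eq_zero.1 hn]
  | succ n ih =>
    obtain ⟨S, hS, hmax⟩ := Finset.exists_max_image A Finset.card
      (Finset.card_pos.1 (by omega))
    have hchain : ∀ m, ∀ R ∈ A, R.card = m → Finset.Icc k m ⊆ A.image Finset.card := by
      intro m
      induction m with
      | zero =>
        intro R hR h0 j hj
        rw [Finset.mem_Icc] at hj
        exact Finset.mem_image.2 ⟨R, hR, by omega⟩
      | succ m ihm =>
        intro R hR hm j hj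
        rw [Finset.mem_Icc] at hj
        by_cases hjm : j = m + 1
        · exact Finset.mem_image.2 ⟨R, hR, by omega⟩
        · obtain ⟨x, hx, hxA⟩ := (hA R hR).2 (by omega)
          exact ihm _ hxA (by rw [Finset.card_erase_of_mem hx]; omega)
            (Finset.mem_Icc.2 ⟨hj.1, by omega⟩)
    have hle := (Finset.card_le_card (hchain _ S hS rfl)).trans Finset.card_image_le
    rw [Nat.card_Icc, hn] at hle
    have hSn : (S.card : ℚ) ≤ n + k := by exact_mod_cast (by omega : S.card ≤ n + k)
    have := ih (A.erase S) (fun R hR => by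
      rw [Finset.mem_erase] at hR
      refine ⟨(hA R hR.2).1, fun h => ?_⟩
      obtain ⟨x, hx, hxA⟩ := (hA R hR.2).2 h
      refine ⟨x, hx, Finset.mem_erase.2 ⟨fun he => ?_, hxA⟩⟩
      have h1 := hmax R hR.2
      have h2 := Finset.card_erase_lt_of_mem hx
      rw [he] at h2
      omega) (by rw [Finset.card_erase_of_mem hS, hn]; rfl)
    have hsum : totalExcess k A = totalExcess k (A.erase S) + (S.card - k) :=
      (Finset.sum_erase_add _ _ hS).symm
    rw [hsum]
    push_cast
    nlinarith

theorem two_mul_totalExcess_le [Fintype V] (hT : KTreeOn k T Finset.univ) {C : Finset V}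
    (hC : T.IsNClique k C) (U : Finset V) :
    2 * totalExcess k (treesBetween k T C U) ≤
      (treesBetween k T C U).card * ((treesBetween k T C U).card - 1) := by
  refine two_mul_sum_card_sub_le k _ fun S hS => ?_
  rw [mem_treesBetween] at hS
  refine ⟨hS.1.1, fun h => ?_⟩
  obtain ⟨x, hx, hF, hCx, -⟩ := exists_isFull_erase hT hC hS.1 hS.2.1
    fun h' => h (by rw [h', hC.card_eq])
  exact ⟨x, (Finset.mem_sdiff.1 hx).1,
    mem_treesBetween.2 ⟨hF, hCx, (Finset.erase_subset _ _).trans hS.2.2⟩⟩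

/-! ### Branches cut out by labels -/

/-- The vertices of `C` together with those whose label satisfies `p`. -/
noncomputable def branch [Fintype V] (C : Finset V) (c : V → V) (p : V → Prop) : Finset V :=
  C ∪ Finset.univ.filter fun x => p (c x)

theorem mem_branch [Fintype V] {C : Finset V} {c : V → V} {p : V → Prop} {x : V} :
    x ∈ branch C c p ↔ x ∈ C ∨ p (c x) := by
  simp [branch]

theorem IsBranchLabel.separates [Fintype V] {C : Finset V} {c : V → V} {p q : V → Prop}
    (h : IsBranchLabel T C Finset.univ c) (hpq : ∀ x, p x → ¬ q x) :
    Separates T C (branch C c p) (branch C c q) where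
  subset_left _ hx := mem_branch.2 (.inl hx)
  subset_right _ hx := mem_branch.2 (.inl hx)
  inter_subset x hx := by
    have := hpq (c x)
    rw [Finset.mem_inter, mem_branch, mem_branch] at hx
    tauto
  not_adj a ha b hb hab := by
    rw [Finset.mem_sdiff, mem_branch] at ha hb
    have := h.adj a (by simp [ha.2]) b (by simp [hb.2]) hab
    refine hpq (c a) (ha.1.resolve_left ha.2) ?_
    rw [this]
    exact hb.1.resolve_left hb.2

/-- The part of `S` in the branch of `x` is a `k`-tree through `C` other than `C`, so it contains a
vertex adjacent to all of `C`; that vertex is its own label. Thus a tree through `C` enters a branch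
only together with its root. -/
theorem IsBranchLabel.label_mem [Fintype V] (hT : KTreeOn k T Finset.univ) {C S : Finset V}
    {c : V → V} (h : IsBranchLabel T C Finset.univ c) (hC : T.IsNClique k C)
    (hS : IsFull k T S) (hCS : C ⊆ S) {x : V} (hx : x ∈ S \ C) :
    c x ∈ S \ C ∧ ∀ u ∈ C, T.Adj (c x) u := by
  have hsep := h.separates (p := (· = c x)) (q := (· ≠ c x)) fun y hy hn => hn hy
  rw [Finset.mem_sdiff] at hx
  have hF := hsep.isFull_inter_left hT hC hS hCS fun y _ => by
    rw [Finset.mem_union, mem_branch, mem_branch]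
    tauto
  obtain ⟨v, hv, hadj⟩ := exists_adj_clique hT hC _ hF
    (Finset.subset_inter hCS hsep.subset_left) fun he => hx.2 (by
      rw [← he, Finset.mem_inter, mem_branch]
      exact ⟨hx.1, .inr rfl⟩)
  rw [Finset.mem_sdiff, Finset.mem_inter, mem_branch] at hv
  have hcv := hv.1.2.resolve_left hv.2
  rw [h.atom v (by simp [hv.2]) hadj] at hcv
  rw [← hcv]
  exact ⟨Finset.mem_sdiff.2 ⟨hv.1.1, hv.2⟩, hadj⟩

/-! ### Comparing two adjacent cliques -/

/-- With `M = s * t` and `Z = t * X + s * Y`, dropping `U` and cross-multiplying reduces the claim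
to `N * (P + 1) * Z < M * W * (M - N)`. This follows from `(P + 1) * Z < M * (M - P)` and `N ≤ P ≤
W`. -/
theorem mean_lt_mean_of_bounds {s t P W X Y N U : ℚ} (hN : 1 ≤ N) (hNP : N ≤ P) (hPW : P ≤ W)
    (hs : P + 1 ≤ s) (ht : P + 1 ≤ t) (hX : 2 * X ≤ s * (s - 1)) (hY : 2 * Y ≤ t * (t - 1))
    (hU : 0 ≤ U) :
    (s * t * W + P * (t * X + s * Y) + (t * X + s * Y)) / (P * (s * t) + s * t) <
      (s * t * W + P * (t * X + s * Y) + U) / (P * (s * t) + N) := by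
  have hs0 : 0 < s := by linarith
  have ht0 : 0 < t := by linarith
  have hM : 0 < s * t := mul_pos hs0 ht0
  have hP : 0 < P := by linarith
  obtain ⟨Z, hZ⟩ : ∃ Z, Z = t * X + s * Y := ⟨_, rfl⟩
  obtain ⟨M, hMd⟩ : ∃ M, M = s * t := ⟨_, rfl⟩
  have hZle : 2 * Z ≤ M * (s + t - 2) := by
    rw [hZ, hMd]
    nlinarith [mul_le_mul_of_nonneg_left hX ht0.le, mul_le_mul_of_nonneg_left hY hs0.le]
  -- Both `(P + 1) * s` and `(P + 1) * t` are at most `M`. Two large factors are needed here, which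
  -- is where the third branch enters.
  have hMge : (P + 1) * (s + t - 2) < 2 * (M - P) := by
    rw [hMd]
    nlinarith [mul_le_mul_of_nonneg_left hs ht0.le, mul_le_mul_of_nonneg_left ht hs0.le]
  rw [← hZ, ← hMd]
  rw [← hMd] at hM
  have hMP : 0 < M - P := by nlinarith
  have h1 : (P + 1) * Z < M * (M - P) := by
    have h2 := mul_le_mul_of_nonneg_left hZle (by linarith : (0 : ℚ) ≤ P + 1)
    have h3 := mul_lt_mul_of_pos_left hMge hM
    nlinarith
  have h4 : N * (M * (M - P)) ≤ M * W * (M - N) := by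
    have h5 : N * (M - P) ≤ W * (M - N) := by nlinarith
    nlinarith [mul_le_mul_of_nonneg_left h5 hM.le]
  have h6 : N * ((P + 1) * Z) < N * (M * (M - P)) := mul_lt_mul_of_pos_left h1 (by linarith)
  have h7 : 0 ≤ U * (M * (P + 1)) := by positivity
  rw [div_lt_div_iff₀ (by positivity) (by positivity)]
  nlinarith

theorem totalExcess_union {A B : Finset (Finset V)} (h : Disjoint A B) :
    totalExcess k (A ∪ B) = totalExcess k A + totalExcess k B :=
  Finset.sum_union h

/-- Moving from a clique with three branches into the branch of `v`, which has no more sub-trees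
than the two others, raises the mean order. -/
theorem exists_cliqueMeanOrder_lt_of_le [Fintype V] (hT : KTreeOn k T Finset.univ) (hk : 1 ≤ k)
    {C : Finset V} (hC : T.IsNClique k C) {c : V → V} (hc : IsBranchLabel T C Finset.univ c)
    {v w z : V} (hv : v ∉ C) (hvadj : ∀ u ∈ C, T.Adj v u) (hwv : w ≠ v) (hzv : z ≠ v)
    (hzw : z ≠ w)
    (hvw : (treesBetween k T C (branch C c (· = v))).card ≤
      (treesBetween k T C (branch C c (· = w))).card)
    (hvz : (treesBetween k T C (branch C c (· = v))).card ≤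
      (treesBetween k T C (branch C c (· = z))).card) :
    ∃ D, T.IsNClique k D ∧ cliqueMeanOrder k T C < cliqueMeanOrder k T D := by
  obtain ⟨u, hu⟩ : C.Nonempty := Finset.card_pos.1 (by rw [hC.card_eq]; omega)
  have hQ : T.IsNClique (k + 1) (insert v C) := hC.insert hvadj
  have huv : u ≠ v := fun h => hv (h ▸ hu)
  have hcv : c v = v := hc.atom v (by simp [hv]) hvadj
  set Q := insert v C with hQdef
  have huQ : u ∈ Q := Finset.mem_insert_of_mem hu
  have hCQ : C ⊆ Q := Finset.subset_insert _ _
  set D := Q.erase u with hDdef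
  have hDQ : insert u D = Q := Finset.insert_erase huQ
  have huD : u ∉ D := Finset.notMem_erase u Q
  have hD : T.IsNClique k D :=
    ⟨hQ.isClique.subset (Finset.coe_subset.2 (Finset.erase_subset _ _)), by
      rw [Finset.card_erase_of_mem huQ, hQ.card_eq]; rfl⟩
  set A := branch C c (· = v) with hAdef
  set B₁ := branch C c (· = w) with hB₁
  -- All branches beyond those of `v` and `w` are lumped together; that of `z` is among them.
  set B₂ := branch C c fun x => x ≠ v ∧ x ≠ w with hB₂
  have hsep : Separates T C A (B₁ ∪ B₂) := by
    have : B₁ ∪ B₂ = branch C c (· ≠ v) := by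
      ext x
      rw [Finset.mem_union, mem_branch, mem_branch, mem_branch]
      by_cases hx : c x = w
      · simp [hx, hwv]
      · simp [hx]
    rw [this]
    exact hc.separates fun x hx hn => hn hx
  have hsep' : Separates T C B₁ B₂ := hc.separates fun x hx hn => hn.2 hx
  have hAB : A ∪ (B₁ ∪ B₂) = Finset.univ := by
    ext x
    simp only [Finset.mem_union, mem_branch, Finset.mem_univ, iff_true, hAdef, hB₁, hB₂]
    tauto
  have hvA : v ∈ A := mem_branch.2 (.inr hcv)
  have hvB : v ∉ B₁ ∪ B₂ := fun h => hv (hsep.inter_subset (Finset.mem_inter.2 ⟨hvA, h⟩))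
  have hQA : Q ⊆ A := Finset.insert_subset hvA hsep.subset_left
  set s := (treesBetween k T C B₁).card with hs
  set t := (treesBetween k T C B₂).card with ht
  set P := (treesBetween k T Q A).card with hP
  -- The trees through `C`.
  have hFC : treesBetween k T C Finset.univ =
      treesBetween k T Q Finset.univ ∪ treesBetween k T C (B₁ ∪ B₂) := by
    ext S
    rw [Finset.mem_union, mem_treesBetween, mem_treesBetween, mem_treesBetween]
    constructor
    · rintro ⟨hS, hCS, hSu⟩
      by_cases hvS : v ∈ S
      · exact .inl ⟨hS, Finset.insert_subset hvS hCS, hSu⟩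
      · refine .inr ⟨hS, hCS, fun x hx => ?_⟩
        by_cases hxC : x ∈ C
        · exact hsep.subset_right hxC
        -- A vertex labelled `v` would bring the root `v` into `S`.
        · have hlab := (hc.label_mem hT hC hS hCS (Finset.mem_sdiff.2 ⟨hx, hxC⟩)).1
          rw [Finset.mem_sdiff] at hlab
          have hcx : c x ≠ v := fun h => hvS (h ▸ hlab.1)
          rw [Finset.mem_union, mem_branch, mem_branch]
          tauto
    · rintro (⟨hS, hQS, hSu⟩ | ⟨hS, hCS, -⟩)
      · exact ⟨hS, hCQ.trans hQS, hSu⟩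
      · exact ⟨hS, hCS, Finset.subset_univ _⟩
  have hdC : Disjoint (treesBetween k T Q Finset.univ) (treesBetween k T C (B₁ ∪ B₂)) := by
    rw [Finset.disjoint_left]
    intro S h1 h2
    rw [mem_treesBetween] at h1 h2
    exact hvB (h2.2.2 (h1.2.1 (Finset.mem_insert_self _ _)))
  -- The trees through `D`.
  set R := (treesBetween k T D Finset.univ).filter (u ∉ ·) with hR
  have hFD : treesBetween k T D Finset.univ = treesBetween k T Q Finset.univ ∪ R := by
    ext S
    rw [Finset.mem_union, hR, Finset.mem_filter, mem_treesBetween, mem_treesBetween, ← hDQ,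
      Finset.insert_subset_iff]
    tauto
  have hdD : Disjoint (treesBetween k T Q Finset.univ) R := by
    rw [Finset.disjoint_left]
    intro S h1 h2
    rw [hR, Finset.mem_filter] at h2
    exact h2.2 ((mem_treesBetween.1 h1).2.1 huQ)
  -- Adding `u` to `S` amounts to gluing `S` and `Q` along `D`, so no edge joins `S \ Q` to `u`. A
  -- vertex outside `A` would bring in the root of another branch, which is adjacent to `u`.
  have hRP : R.card ≤ P := by
    refine Finset.card_le_card_of_injOn (insert u) (fun S hS => ?_) fun S hS S' hS' he => ?_
    · rw [hR, Finset.mem_coe, Finset.mem_filter, mem_treesBetween] at hS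
      obtain ⟨⟨hS, hDS, -⟩, huS⟩ := hS
      have hun : S ∪ Q = insert u S := by
        rw [← hDQ, Finset.union_insert, Finset.union_eq_left.2 hDS]
      have hin : S ∩ Q = D := by
        rw [← hDQ, Finset.inter_insert_of_notMem huS, Finset.inter_eq_right.2 hDS]
      obtain ⟨hF, -, hna⟩ := isFull_union_inter hT (Finset.subset_univ S) (Finset.subset_univ Q)
        hS (isFull_of_isNClique_succ hQ) (by rw [hin, hD.card_eq])
      have hQS : Q ⊆ S ∪ Q := Finset.subset_union_right
      rw [hun] at hF hQS
      rw [Finset.mem_coe, mem_treesBetween]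
      refine ⟨hF, hQS, fun x hx => ?_⟩
      rw [hAdef, mem_branch]
      by_contra! hxA
      obtain ⟨h1, h2⟩ := hc.label_mem hT hC hF (hCQ.trans hQS) (Finset.mem_sdiff.2 ⟨hx, hxA.1⟩)
      rw [Finset.mem_sdiff, Finset.mem_insert] at h1
      have hne : c x ≠ u := fun h => h1.2 (h ▸ hu)
      refine hna (c x) (Finset.mem_sdiff.2 ⟨h1.1.resolve_left hne, fun h => ?_⟩) u
        (Finset.mem_sdiff.2 ⟨huQ, huS⟩) (h2 u hu)
      rcases Finset.mem_insert.1 h with h | h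
      · exact hxA.2 h
      · exact h1.2 h
    · rw [hR, Finset.mem_coe, Finset.mem_filter] at hS hS'
      rw [← Finset.erase_insert hS.2, ← Finset.erase_insert hS'.2, he]
  have hR1 : 1 ≤ R.card := Finset.card_pos.2 ⟨D, Finset.mem_filter.2
    ⟨self_mem_treesBetween hD (Finset.subset_univ _), huD⟩⟩
  have hU : 0 ≤ totalExcess k R := by
    refine Finset.sum_nonneg fun S hS => ?_
    rw [hR, Finset.mem_filter, mem_treesBetween] at hS
    have : (k : ℚ) ≤ S.card := by exact_mod_cast hS.1.1.1
    linarith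
  -- Sizes of the branches.
  have hPW : (P : ℚ) ≤ totalExcess k (treesBetween k T Q A) := by
    have := Finset.card_nsmul_le_sum (treesBetween k T Q A) (fun S => (S.card : ℚ) - k) 1
      fun S hS => by
        have h1 := Finset.card_le_card (mem_treesBetween.1 hS).2.1
        rw [hQ.card_eq] at h1
        have h2 : ((k + 1 : ℕ) : ℚ) ≤ S.card := by exact_mod_cast h1
        push_cast at h2
        linarith
    rwa [nsmul_eq_mul, mul_one] at this
  -- The extra tree is `C` itself.
  have hPA : P + 1 ≤ (treesBetween k T C A).card := by
    have hnot : C ∉ treesBetween k T Q A := fun h =>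
      hv ((mem_treesBetween.1 h).2.1 (Finset.mem_insert_self _ _))
    rw [hP, ← Finset.card_insert_of_notMem hnot]
    refine Finset.card_le_card (Finset.insert_subset
      (self_mem_treesBetween hC hsep.subset_left) fun S hS => ?_)
    rw [mem_treesBetween] at hS ⊢
    exact ⟨hS.1, hCQ.trans hS.2.1, hS.2.2⟩
  have hPs : P + 1 ≤ s := hPA.trans hvw
  have hPt : P + 1 ≤ t := by
    refine (hPA.trans hvz).trans (Finset.card_le_card fun S hS => ?_)
    rw [mem_treesBetween] at hS ⊢
    refine ⟨hS.1, hS.2.1, hS.2.2.trans fun x hx => ?_⟩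
    rw [hB₂, mem_branch]
    rw [mem_branch] at hx
    rcases hx with hx | hx
    · exact .inl hx
    · exact .inr (by rw [hx]; exact ⟨hzv, hzw⟩)
  refine ⟨D, hD, ?_⟩
  have hM := hsep'.card_eq hT hC subset_rfl hsep'.subset_left
  have hMe := hsep'.totalExcess_eq hT hC subset_rfl hsep'.subset_left
  have hA := hsep.card_eq hT hC hCQ hQA
  have hAe := hsep.totalExcess_eq hT hC hCQ hQA
  rw [hAB] at hA hAe
  rw [hM] at hA hAe
  rw [hMe] at hAe
  rw [cliqueMeanOrder_eq hT hC, cliqueMeanOrder_eq hT hD, hFC, hFD, totalExcess_union hdC,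
    totalExcess_union hdD, Finset.card_union_of_disjoint hdC, Finset.card_union_of_disjoint hdD,
    Nat.cast_add, Nat.cast_add, hM, hMe, hA, hAe, add_lt_add_iff_left]
  exact mean_lt_mean_of_bounds (by exact_mod_cast hR1) (by exact_mod_cast hRP) hPW
    (by exact_mod_cast hPs) (by exact_mod_cast hPt) (two_mul_totalExcess_le hT hC _)
    (two_mul_totalExcess_le hT hC _) hU

/-! ### Major cliques are not optimal -/

theorem exists_eq_insert_of_isNClique_succ {C Q : Finset V} (hC : T.IsNClique k C)
    (hQ : T.IsNClique (k + 1) Q) (hCQ : C ⊆ Q) :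
    ∃ v, v ∉ C ∧ (∀ u ∈ C, T.Adj v u) ∧ Q = insert v C := by
  obtain ⟨v, hvQ, hvC⟩ := Finset.exists_mem_notMem_of_card_lt_card
    (by rw [hC.card_eq, hQ.card_eq]; omega : C.card < Q.card)
  refine ⟨v, hvC, fun u hu => hQ.isClique hvQ (hCQ hu) fun h => hvC (h ▸ hu), ?_⟩
  refine (Finset.eq_of_subset_of_card_le (Finset.insert_subset hvQ hCQ) ?_).symm
  rw [Finset.card_insert_of_notMem hvC, hC.card_eq, hQ.card_eq]

theorem IsMajorClique.exists_cliqueMeanOrder_lt [Fintype V] (hT : KTreeOn k T Finset.univ)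
    (hk : 1 ≤ k) {C : Finset V} (h : IsMajorClique k T C) :
    ∃ D, T.IsNClique k D ∧ cliqueMeanOrder k T C < cliqueMeanOrder k T D := by
  obtain ⟨hC, hdeg⟩ := h
  obtain ⟨Q₁, Q₂, Q₃, h₁, h₂, h₃, h₁₂, h₁₃, h₂₃⟩ :=
    (Set.two_lt_ncard_iff (Set.toFinite _)).1 (Nat.lt_of_succ_le hdeg)
  obtain ⟨v, hv, hva, rfl⟩ := exists_eq_insert_of_isNClique_succ hC h₁.1 h₁.2
  obtain ⟨w, hw, hwa, rfl⟩ := exists_eq_insert_of_isNClique_succ hC h₂.1 h₂.2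
  obtain ⟨z, hz, hza, rfl⟩ := exists_eq_insert_of_isNClique_succ hC h₃.1 h₃.2
  have hvw : v ≠ w := fun h => h₁₂ (by rw [h])
  have hvz : v ≠ z := fun h => h₁₃ (by rw [h])
  have hwz : w ≠ z := fun h => h₂₃ (by rw [h])
  obtain ⟨c, hc⟩ := exists_isBranchLabel hT hC _ hT.isFull (Finset.subset_univ C)
  -- The clique moves into whichever of the three branches minimises `n`.
  set n : V → ℕ := fun x => (treesBetween k T C (branch C c (· = x))).card with hn
  rcases le_total (n v) (n w) with h1 | h1
  · rcases le_total (n v) (n z) with h2 | h2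
    · exact exists_cliqueMeanOrder_lt_of_le hT hk hC hc hv hva hvw.symm hvz.symm hwz.symm h1 h2
    · exact exists_cliqueMeanOrder_lt_of_le hT hk hC hc hz hza hvz hwz hvw.symm h2 (h2.trans h1)
  · rcases le_total (n w) (n z) with h2 | h2
    · exact exists_cliqueMeanOrder_lt_of_le hT hk hC hc hw hwa hvw hwz.symm hvz.symm h1 h2
    · exact exists_cliqueMeanOrder_lt_of_le hT hk hC hc hz hza hvz hwz hvw.symm (h2.trans h1) h2

theorem one_le_cliqueDegree [Fintype V] (hT : KTreeOn k T Finset.univ) {C : Finset V}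
    (hC : T.IsNClique k C) (hne : ¬ IsTrivialKTree k T) : 1 ≤ cliqueDegree k T C := by
  have huniv : Finset.univ ≠ C := by
    rintro rfl
    refine hne ⟨⟨Fintype.equivFinOfCardEq hC.card_eq, fun {a b} => ?_⟩⟩
    rw [SimpleGraph.top_adj, (Fintype.equivFinOfCardEq hC.card_eq).injective.ne_iff]
    exact ⟨fun h => hC.isClique (by simp) (by simp) h, fun h => h.ne⟩
  obtain ⟨v, -, hadj⟩ := exists_adj_clique hT hC _ hT.isFull (Finset.subset_univ C) huniv
  exact (Set.ncard_pos (Set.toFinite _)).2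
    ⟨insert v C, hC.insert hadj, Finset.subset_insert _ _⟩

theorem KTreeOn.exists_isNClique {S : Finset V} (hS : KTreeOn k T S) :
    ∃ C, T.IsNClique k C := by
  cases hS with
  | clique hS => exact ⟨_, hS⟩
  | addVertex _ _ hC _ _ => exact ⟨_, hC⟩

end

theorem mainTheorem1 {V : Type u} [Finite V] (k : ℕ) (hk : 1 ≤ k) (T : SimpleGraph V)
    (hT : IsKTree k T) :
    (∃ C : Finset V, AttainsMaxLocalMeanOrder k T C ∧ ¬ IsMajorClique k T C) ∧
    (∀ C : Finset V, AttainsMaxLocalMeanOrder k T C →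
      ¬ IsMajorClique k T C ∧
      (¬ IsTrivialKTree k T → cliqueDegree k T C = 1 ∨ cliqueDegree k T C = 2)) := by
  have := Fintype.ofFinite V
  have hTu : KTreeOn k T Finset.univ := by
    obtain ⟨S, hS, hKS⟩ := hT.exists_kTreeOn
    rwa [← Finset.eq_univ_iff_forall.2 hS]
  have hmaj : ∀ C : Finset V, AttainsMaxLocalMeanOrder k T C → ¬ IsMajorClique k T C := by
    intro C hC hM
    obtain ⟨D, hD, hlt⟩ := hM.exists_cliqueMeanOrder_lt hTu hk
    exact absurd (hC.2 D hD) (not_le.2 hlt)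
  refine ⟨?_, fun C hC => ⟨hmaj C hC, fun hne => ?_⟩⟩
  · obtain ⟨C, hC, hmax⟩ := Set.exists_max_image {C : Finset V | T.IsNClique k C}
      (cliqueMeanOrder k T) (Set.toFinite _) hTu.exists_isNClique
    exact ⟨C, ⟨hC, hmax⟩, hmaj C ⟨hC, hmax⟩⟩
  · have h1 := one_le_cliqueDegree hTu hC.1 hne
    have h2 : ¬ 3 ≤ cliqueDegree k T C := fun h => hmaj C hC ⟨hC.1, h⟩
    omega
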